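/- Let $p,q$ be real numbers with either $p\in(1,2)$ and $q\in(2,\infty)$, or $p\in(2,\infty)$ and $q\in(1,2)$. Let $\ell_p(\ell_q)$ be the real Banach space of all sequences $x=(x(k))_{k\in\mathbb N}$ in the real space $\ell_q$ with norm $$\|x\|=\Big(\sum_{k}\|x(k)\|_q^p\Big)^{1/p}<\infty .$$ Call $x,y\in\ell_p(\ell_q)$ disjoint if for all $k,j\in\mathbb N$ at least one of the coordinates $x(k)_j$, $y(k)_j$ is $0$. Then for every contractive projection $P$ on $\ell_p(\ell_q)$, i.e. every linear operator $P\colon\ell_p(\ell_q)\to\ell_p(\ell_q)$ with $P^2=P$ and $\|P\|\le 1$, the range of $P$ has a block basis: it has a basis $\{y_i\}_{i=1}^{d}$, where $d\in\{0,1,2,\dots\}\cup\{\infty\}$ is the dimension of the range (a Schauder basis if $d=\infty$), such that $y_i$ and $y_j$ are disjoint whenever $i\ne j$. -/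

import Mathlib

open scoped ENNReal

/-- The real vector-valued sequence space `ℓ_p(ℓ_q)`: all `x : ℕ → ℓ_q` with
`∑ₖ ‖x k‖_q ^ p < ∞`, with the norm `(∑ₖ ‖x k‖_q ^ p) ^ (1 / p)` (for `1 ≤ p < ∞`). -/
abbrev EllPEllQ (p q : ℝ≥0∞) [Fact (1 ≤ q)] : Type :=
  lp (fun _ : ℕ => lp (fun _ : ℕ => ℝ) q) p

namespace EllPEllQ

variable {p q : ℝ≥0∞} [Fact (1 ≤ p)] [Fact (1 ≤ q)]

/-- The support of `x` with respect to the canonical basis `(e_{kj})` of `ℓ_p(ℓ_q)`. -/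
def supp (x : EllPEllQ p q) : Set (ℕ × ℕ) := {i | x i.1 i.2 ≠ 0}

/-- Disjoint elements of `ℓ_p(ℓ_q)`: their supports do not meet. -/
def AreDisjoint (x y : EllPEllQ p q) : Prop := supp x ∩ supp y = ∅

/-- A subspace `Y` has a block basis if it has a basis of pairwise disjoint vectors: a finite basis
if `Y` is finite-dimensional (possibly empty, for `Y = 0`), a Schauder basis of the normed space
`Y`, indexed by `ℕ`, otherwise. -/
def HasBlockBasis (Y : Submodule ℝ (EllPEllQ p q)) : Prop :=
  (∃ (n : ℕ) (b : Module.Basis (Fin n) ℝ Y),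
    ∀ i j, i ≠ j → AreDisjoint (b i : EllPEllQ p q) (b j : EllPEllQ p q)) ∨
  (∃ b : SchauderBasis ℝ Y,
    ∀ i j, i ≠ j → AreDisjoint (b i : EllPEllQ p q) (b j : EllPEllQ p q))

/-- A contractive projection: an idempotent linear operator of norm at most one. -/
structure IsContractiveProjection (P : EllPEllQ p q →L[ℝ] EllPEllQ p q) : Prop where
  idem : ∀ x, P (P x) = P x
  contractive : ∀ x, ‖P x‖ ≤ ‖x‖

end EllPEllQ

/-!
Write `δ_r(u, v) = ‖u + v‖ ^ r + ‖u - v‖ ^ r - 2 ‖u‖ ^ r`. If `P x = x`, then contractivity of `P`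
gives `δ_p(x, t P z) ≤ δ_p(x, t z)`, the first-order terms having cancelled. On `ℓ_p(ℓ_q)` the
quantity `δ_p` is a sum of nonnegative terms, one for each row, so every row of `x` and `P z` obeys
the bound. For `z = e_{kj}` the right side involves the row `k` only, and its order as `t → 0`
depends on `x`:
it is `t ^ p` if the row `x k` vanishes, at most `t ^ 2` if `x k j ≠ 0`, and of order `t ^ q` if
`x k ≠ 0 = x k j` (for `p < 2 < q`). Comparing with the order of each row on the left side forces
coordinates of `P e_{kj}` to vanish. With `K` the set of coordinates in the nonzero rows of `x`, and
`A ⊆ K` the support of `x`, the vectors supported in `K`, and those supported in `K \ A`, form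
subspaces invariant under `P` if `p < 2 < q`; if `q < 2 < p`, the same is true of the complements
of these sets (`IsContractiveProjection.apply_unitVec_of_lt`,
`IsContractiveProjection.apply_unitVec_of_gt`).

By strict monotonicity of the norm, if the vectors supported in `S` form an invariant subspace and
`P y = y`, then `P` fixes the restriction of `y` to the complement of `S`
(`IsContractiveProjection.apply_restrict_compl`). It follows that the range of `P` is closed under
restriction to the support of any of its elements
(`IsContractiveProjection.apply_restrict_supp`).

A closed subspace `Y` with this property has a block basis (`hasBlockBasis_of_restrict_supp_mem`):
link two coordinates if no element of `Y` vanishes at exactly one of them. Restriction to a class of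
linked coordinates preserves `Y`, and the elements of `Y` supported in one class are multiples of
each other.

The lower bounds for `δ_p` come from two comparisons. For `q ≤ p` the convexity of `s ↦ s ^ (p / q)`
bounds `δ_p` below by a multiple of `δ_q`, which is a sum over coordinates (`le_secondDiff_of_le`).
For `p < q` Hölder's inequality gives a minorant of `‖v‖ ^ p` that touches it at `v = u` and is a
weighted sum of the `|v j| ^ p` (`mul_secondDiff_apply_le`).
-/

namespace EllPEllQ

open Filter Topology

/-! ### Second differences -/

/-- The symmetric second difference at `u`, in the direction `v`, of the `r`-th power of the
norm. -/
noncomputable def secondDiff {E : Type*} [NormedAddCommGroup E] (r : ℝ) (u v : E) : ℝ :=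
  ‖u + v‖ ^ r + ‖u - v‖ ^ r - 2 * ‖u‖ ^ r

section General

variable {E : Type*} [NormedAddCommGroup E]

theorem secondDiff_neg_left (r : ℝ) (u v : E) : secondDiff r (-u) v = secondDiff r u v := by
  have h1 : ‖-u + v‖ = ‖u - v‖ := by rw [← norm_neg]; congr 1; abel
  have h2 : ‖-u - v‖ = ‖u + v‖ := by rw [← norm_neg]; congr 1; abel
  simp only [secondDiff, h1, h2, norm_neg]
  ring

theorem secondDiff_zero_left {r : ℝ} (hr : 0 < r) (v : E) :
    secondDiff r 0 v = 2 * ‖v‖ ^ r := by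
  simp only [secondDiff, zero_add, zero_sub, norm_neg, norm_zero, Real.zero_rpow hr.ne']
  ring

theorem secondDiff_zero_right (r : ℝ) (u : E) : secondDiff r u 0 = 0 := by
  simp only [secondDiff, add_zero, sub_zero]
  ring

theorem secondDiff_nonneg [NormedSpace ℝ E] {r : ℝ} (hr : 1 ≤ r) (u v : E) :
    0 ≤ secondDiff r u v := by
  have h1 : 2 * ‖u‖ ≤ ‖u + v‖ + ‖u - v‖ := by
    have : (u + v) + (u - v) = (2 : ℝ) • u := by rw [two_smul]; abel
    calc 2 * ‖u‖ = ‖(u + v) + (u - v)‖ := by rw [this, norm_smul]; norm_num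
      _ ≤ _ := norm_add_le _ _
  have h2 := (convexOn_rpow hr).2 (norm_nonneg (u + v)) (norm_nonneg (u - v))
    (by norm_num : (0 : ℝ) ≤ 1 / 2) (by norm_num : (0 : ℝ) ≤ 1 / 2) (by norm_num)
  simp only [smul_eq_mul] at h2
  have h3 : ‖u‖ ^ r ≤ (1 / 2 * ‖u + v‖ + 1 / 2 * ‖u - v‖) ^ r :=
    Real.rpow_le_rpow (norm_nonneg _) (by linarith) (by linarith)
  unfold secondDiff
  linarith

/-- The tangent line bound `X ^ (r / s) ≥ S ^ (r / s) + (r / s) S ^ (r / s - 1) (X - S)` at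
`S = ‖u‖ ^ s` passes from exponent `s` to a larger exponent `r`. -/
theorem le_secondDiff_of_le {r s : ℝ} (hs : 0 < s) (hsr : s ≤ r) {u : E} (hu : u ≠ 0) (v : E) :
    r / s * ‖u‖ ^ (r - s) * secondDiff s u v ≤ secondDiff r u v := by
  have hu' : 0 < ‖u‖ := norm_pos_iff.2 hu
  have key : ∀ z : E, ‖u‖ ^ r + r / s * ‖u‖ ^ (r - s) * (‖z‖ ^ s - ‖u‖ ^ s) ≤ ‖z‖ ^ r := by
    intro z
    have hq : 0 ≤ (‖z‖ / ‖u‖) ^ s := by positivity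
    have := one_add_mul_self_le_rpow_one_add (s := (‖z‖ / ‖u‖) ^ s - 1) (by linarith)
      ((one_le_div hs).2 hsr)
    rw [add_sub_cancel, ← Real.rpow_mul (by positivity), mul_div_cancel₀ _ hs.ne',
      Real.div_rpow (norm_nonneg _) hu'.le, Real.div_rpow (norm_nonneg _) hu'.le,
      le_div_iff₀ (by positivity)] at this
    refine le_trans (le_of_eq ?_) this
    rw [Real.rpow_sub hu']
    field_simp
  have h1 := key (u + v)
  have h2 := key (u - v)
  unfold secondDiff
  linarith

/-- The counterpart of `le_secondDiff_of_le` for a smaller exponent `r`, where `X ^ (r / s)` is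
concave. -/
theorem secondDiff_le_of_le {r s : ℝ} (hr : 0 ≤ r) (hs : 0 < s) (hrs : r ≤ s) {u : E}
    (hu : u ≠ 0) (v : E) :
    secondDiff r u v ≤ r / s * ‖u‖ ^ (r - s) * secondDiff s u v := by
  have hu' : 0 < ‖u‖ := norm_pos_iff.2 hu
  have key : ∀ z : E, ‖z‖ ^ r ≤ ‖u‖ ^ r + r / s * ‖u‖ ^ (r - s) * (‖z‖ ^ s - ‖u‖ ^ s) := by
    intro z
    have hq : 0 ≤ (‖z‖ / ‖u‖) ^ s := by positivity
    have := rpow_one_add_le_one_add_mul_self (s := (‖z‖ / ‖u‖) ^ s - 1) (by linarith)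
      (div_nonneg hr hs.le) ((div_le_one hs).2 hrs)
    rw [add_sub_cancel, ← Real.rpow_mul (by positivity), mul_div_cancel₀ _ hs.ne',
      Real.div_rpow (norm_nonneg _) hu'.le, Real.div_rpow (norm_nonneg _) hu'.le,
      div_le_iff₀ (by positivity)] at this
    refine this.trans (le_of_eq ?_)
    rw [Real.rpow_sub hu']
    field_simp
  have h1 := key (u + v)
  have h2 := key (u - v)
  unfold secondDiff
  linarith

end General

section Lp

variable {ι : Type*} {E : ι → Type*} [∀ i, NormedAddCommGroup (E i)] {r : ℝ≥0∞} [Fact (1 ≤ r)]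

theorem hasSum_secondDiff (hr : 0 < r.toReal) (x v : lp E r) :
    HasSum (fun i => secondDiff r.toReal (x i) (v i)) (secondDiff r.toReal x v) :=
  ((lp.hasSum_norm hr (x + v)).add (lp.hasSum_norm hr (x - v))).sub
    ((lp.hasSum_norm hr x).mul_left 2)

theorem secondDiff_apply_le [∀ i, NormedSpace ℝ (E i)] (hr : 1 ≤ r.toReal) (x v : lp E r)
    (i : ι) : secondDiff r.toReal (x i) (v i) ≤ secondDiff r.toReal x v :=
  le_hasSum (hasSum_secondDiff (by linarith) x v) i fun _ _ => secondDiff_nonneg hr _ _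

theorem secondDiff_single [DecidableEq ι] (hr : 0 < r.toReal) (x : lp E r) (i : ι) (a : E i) :
    secondDiff r.toReal x (lp.single r i a) = secondDiff r.toReal (x i) a := by
  have h := hasSum_single (f := fun j => secondDiff r.toReal (x j) (lp.single r i a j)) i
    fun j hj => by rw [lp.single_apply_ne r i a hj, secondDiff_zero_right]
  rw [lp.single_apply_self] at h
  exact (hasSum_secondDiff hr x _).unique h

/-- For `a < r` Hölder's inequality shows that
`v ↦ (∑ i, ‖u i‖ ^ (r - a) * ‖v i‖ ^ a) / ‖u‖ ^ (r - a)` is a minorant of the `a`-th power of the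
norm of `ℓ_r`. It is exact at `v = u`, so the second difference of the norm dominates that of each
of its terms. -/
theorem mul_secondDiff_apply_le [∀ i, NormedSpace ℝ (E i)] {a : ℝ} (ha : 1 ≤ a)
    (har : a < r.toReal) (u v : lp E r) (i : ι) :
    ‖u i‖ ^ (r.toReal - a) * secondDiff a (u i) (v i)
      ≤ ‖u‖ ^ (r.toReal - a) * secondDiff a u v := by
  have hr : 0 < r.toReal := by linarith
  have hra : 0 < r.toReal - a := by linarith
  have hconj : (r.toReal / (r.toReal - a)).HolderConjugate (r.toReal / a) := by
    rw [Real.holderConjugate_iff]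
    refine ⟨(one_lt_div hra).2 (by linarith), ?_⟩
    field_simp
    ring
  have key : ∀ z : lp E r, Summable (fun j => ‖u j‖ ^ (r.toReal - a) * ‖z j‖ ^ a) ∧
      ∑' j, ‖u j‖ ^ (r.toReal - a) * ‖z j‖ ^ a ≤ ‖u‖ ^ (r.toReal - a) * ‖z‖ ^ a := by
    intro z
    have e1 : ∀ j, (‖u j‖ ^ (r.toReal - a)) ^ (r.toReal / (r.toReal - a)) = ‖u j‖ ^ r.toReal :=
      fun j => by rw [← Real.rpow_mul (norm_nonneg _), mul_div_cancel₀ _ hra.ne']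
    have e2 : ∀ j, (‖z j‖ ^ a) ^ (r.toReal / a) = ‖z j‖ ^ r.toReal :=
      fun j => by rw [← Real.rpow_mul (norm_nonneg _), mul_div_cancel₀ _ (by linarith)]
    have := Real.summable_and_inner_le_Lp_mul_Lq_tsum_of_nonneg hconj
      (f := fun j => ‖u j‖ ^ (r.toReal - a)) (g := fun j => ‖z j‖ ^ a)
      (fun j => by positivity) (fun j => by positivity)
      (by simpa only [e1] using (lp.memℓp u).summable hr)
      (by simpa only [e2] using (lp.memℓp z).summable hr)
    simp only [e1, e2] at this
    rw [← lp.norm_rpow_eq_tsum hr, ← lp.norm_rpow_eq_tsum hr, ← Real.rpow_mul (lp.norm_nonneg' _),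
      ← Real.rpow_mul (lp.norm_nonneg' _), one_div_div, one_div_div, mul_div_cancel₀ _ hr.ne',
      mul_div_cancel₀ _ hr.ne'] at this
    exact this
  have hu : ∑' j, ‖u j‖ ^ (r.toReal - a) * ‖u j‖ ^ a = ‖u‖ ^ (r.toReal - a) * ‖u‖ ^ a := by
    have e : ∀ t : ℝ, 0 ≤ t → t ^ (r.toReal - a) * t ^ a = t ^ r.toReal := fun t ht => by
      rw [← Real.rpow_add_of_nonneg ht hra.le (by linarith), sub_add_cancel]
    rw [e _ (lp.norm_nonneg' u), lp.norm_rpow_eq_tsum hr]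
    exact tsum_congr fun j => e _ (norm_nonneg _)
  have hs : HasSum (fun j => ‖u j‖ ^ (r.toReal - a) * secondDiff a (u j) (v j)) _ :=
    (((key (u + v)).1.hasSum.add (key (u - v)).1.hasSum).sub
      ((key u).1.hasSum.mul_left 2)).congr_fun fun j => by
        change _ = ‖u j‖ ^ (r.toReal - a) * ‖u j + v j‖ ^ a +
          ‖u j‖ ^ (r.toReal - a) * ‖u j - v j‖ ^ a - 2 * (‖u j‖ ^ (r.toReal - a) * ‖u j‖ ^ a)
        unfold secondDiff
        ring
  refine (le_hasSum hs i fun j _ => mul_nonneg (by positivity) (secondDiff_nonneg ha _ _)).trans ?_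
  have h1 := (key (u + v)).2
  have h2 := (key (u - v)).2
  rw [hu]
  unfold secondDiff
  linarith

end Lp

/-! ### Orders of vanishing of second differences -/

theorem tendsto_symm_second_diff {f f' : ℝ → ℝ} {c : ℝ}
    (hf : ∀ᶠ t in 𝓝 0, HasDerivAt f (f' t) t) (hf' : HasDerivAt f' c 0) :
    Tendsto (fun t => (f t + f (-t) - 2 * f 0) / t ^ 2) (𝓝[≠] 0) (𝓝 c) := by
  have hneg : Tendsto (fun t : ℝ => -t) (𝓝 0) (𝓝 0) := by
    simpa using (continuous_neg (G := ℝ)).tendsto 0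
  have h0 : HasDerivAt f (f' 0) 0 := hf.self_of_nhds
  refine HasDerivAt.lhopital_zero_nhdsNE (f' := fun t => f' t - f' (-t)) (g' := fun t => 2 * t)
    ?_ ?_ ?_ ?_ ?_ ?_
  · refine eventually_nhdsWithin_of_eventually_nhds ?_
    filter_upwards [hf, hneg.eventually hf] with t h1 h2
    have h3 : HasDerivAt (fun s => f (-s)) (f' (-t) * (-1)) t :=
      HasDerivAt.comp t h2 (hasDerivAt_neg t)
    exact ((h1.add h3).sub_const (2 * f 0)).congr_deriv (by ring)
  · exact Eventually.of_forall fun t => by simpa using hasDerivAt_pow 2 t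
  · filter_upwards [self_mem_nhdsWithin] with t ht
    simpa using ht
  · refine Tendsto.mono_left ?_ nhdsWithin_le_nhds
    have h4 : Tendsto f (𝓝 0) (𝓝 (f 0)) := h0.continuousAt
    have h5 : Tendsto (fun t => f (-t)) (𝓝 0) (𝓝 (f 0)) := h4.comp hneg
    simpa [two_mul] using (h4.add h5).sub_const (2 * f 0)
  · refine Tendsto.mono_left ?_ nhdsWithin_le_nhds
    simpa using (continuous_pow (M := ℝ) 2).tendsto 0
  · have h5 : HasDerivAt (fun t => f' t - f' (-t)) (2 * c) 0 := by
      have : HasDerivAt (fun s => f' (-s)) (c * (-1)) 0 :=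
        HasDerivAt.comp 0 (by simpa using hf') (hasDerivAt_neg 0)
      exact (hf'.sub this).congr_deriv (by ring)
    have h6 := (hasDerivAt_iff_tendsto_slope.1 h5).const_mul (1 / 2)
    refine (h6.congr' ?_).trans (le_of_eq (by congr 1; ring))
    filter_upwards [self_mem_nhdsWithin] with t ht
    have ht' : t ≠ 0 := ht
    simp only [slope_def_field, neg_zero, sub_self, sub_zero]
    field_simp

/-- Near `0` a positive multiple of `t ^ a` is not bounded by a multiple of `t ^ b` if `a < b`. -/
theorem not_eventually_mul_rpow_le {a b c C : ℝ} (hab : a < b) (hc : 0 < c) :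
    ¬ ∀ᶠ t in 𝓝[>] (0 : ℝ), c * t ^ a ≤ C * t ^ b := by
  intro h
  have hlim : Tendsto (fun t : ℝ => C * t ^ (b - a)) (𝓝[>] 0) (𝓝 0) := by
    have := ((Real.continuousAt_rpow_const 0 (b - a) (Or.inr (by linarith))).tendsto).const_mul C
    rw [Real.zero_rpow (by linarith), mul_zero] at this
    exact this.mono_left nhdsWithin_le_nhds
  obtain ⟨t, ⟨h1, h2⟩, ht⟩ :=
    ((h.and (hlim.eventually (gt_mem_nhds hc))).and self_mem_nhdsWithin).exists
  have ht : 0 < t := ht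
  have : C * t ^ b = C * t ^ (b - a) * t ^ a := by
    rw [mul_assoc, ← Real.rpow_add ht, sub_add_cancel]
  have hpos : 0 < t ^ a := Real.rpow_pos_of_pos ht a
  nlinarith

theorem exists_eventually_le_of_tendsto_div {g : ℝ → ℝ} {c : ℝ}
    (h : Tendsto (fun t => g t / t ^ 2) (𝓝[≠] 0) (𝓝 c)) :
    ∃ C, ∀ᶠ t in 𝓝[>] 0, g t ≤ C * t ^ (2 : ℝ) := by
  have h' := h.mono_left (nhdsWithin_mono 0 fun t (ht : t ∈ Set.Ioi 0) => (ne_of_gt ht : t ≠ 0))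
  refine ⟨c + 1, ?_⟩
  filter_upwards [h'.eventually (gt_mem_nhds (lt_add_one c)), self_mem_nhdsWithin] with t h1 ht
  have ht : 0 < t := ht
  rw [div_lt_iff₀ (by positivity)] at h1
  exact_mod_cast h1.le

theorem exists_eventually_ge_of_tendsto_div {g : ℝ → ℝ} {c : ℝ} (hc : 0 < c)
    (h : Tendsto (fun t => g t / t ^ 2) (𝓝[≠] 0) (𝓝 c)) :
    ∃ C, 0 < C ∧ ∀ᶠ t in 𝓝[>] 0, C * t ^ (2 : ℝ) ≤ g t := by
  have h' := h.mono_left (nhdsWithin_mono 0 fun t (ht : t ∈ Set.Ioi 0) => (ne_of_gt ht : t ≠ 0))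
  refine ⟨c / 2, half_pos hc, ?_⟩
  filter_upwards [h'.eventually (lt_mem_nhds (half_lt_self hc)), self_mem_nhdsWithin] with t h1 ht
  have ht : 0 < t := ht
  rw [lt_div_iff₀ (by positivity)] at h1
  exact_mod_cast h1.le

theorem tendsto_secondDiff_real {r a : ℝ} (ha : a ≠ 0) (b : ℝ) :
    Tendsto (fun t => secondDiff r a (t * b) / t ^ 2) (𝓝[≠] 0)
      (𝓝 (r * (r - 1) * |a| ^ (r - 2) * b ^ 2)) := by
  wlog hpos : 0 < a generalizing a
  · have := this (a := -a) (neg_ne_zero.2 ha)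
      (neg_pos.2 (lt_of_le_of_ne (not_lt.1 hpos) ha))
    simpa only [secondDiff_neg_left, abs_neg] using this
  have hnear : ∀ᶠ t in 𝓝 (0 : ℝ), 0 < a + t * b := by
    have : ContinuousAt (fun t : ℝ => a + t * b) 0 := by fun_prop
    exact this.eventually (lt_mem_nhds (by simpa using hpos))
  have hneg : Tendsto (fun t : ℝ => -t) (𝓝 0) (𝓝 0) := by
    simpa using (continuous_neg (G := ℝ)).tendsto 0
  have hlin : ∀ t, HasDerivAt (fun t : ℝ => a + t * b) b t := fun t => by
    simpa using ((hasDerivAt_id t).mul_const b).const_add a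
  have hd : ∀ s, ∀ t, 0 < a + t * b →
      HasDerivAt (fun t => (a + t * b) ^ s) (b * s * (a + t * b) ^ (s - 1)) t :=
    fun s t ht => (hlin t).rpow_const (Or.inl ht.ne')
  have h := tendsto_symm_second_diff (f := fun t => (a + t * b) ^ r)
    (hnear.mono fun t ht => hd r t ht) ((hd (r - 1) 0 (by simpa using hpos)).const_mul (b * r))
  have hc : b * r * (b * (r - 1) * (a + 0 * b) ^ (r - 1 - 1))
      = r * (r - 1) * |a| ^ (r - 2) * b ^ 2 := by
    rw [abs_of_pos hpos, zero_mul, add_zero, show r - 1 - 1 = r - 2 by ring]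
    ring
  rw [← hc]
  refine h.congr' (eventually_nhdsWithin_of_eventually_nhds ?_)
  filter_upwards [hnear, hneg.eventually hnear] with t h1 h2
  have h3 : 0 < a - t * b := by linarith
  simp only [secondDiff, Real.norm_eq_abs, abs_of_pos h1, abs_of_pos h3, abs_of_pos hpos, neg_mul,
    zero_mul, add_zero, ← sub_eq_add_neg]

theorem secondDiff_real_zero {r t : ℝ} (hr : 0 < r) (ht : 0 < t) (b : ℝ) :
    secondDiff r (0 : ℝ) (t * b) = 2 * |b| ^ r * t ^ r := by
  rw [secondDiff_zero_left hr, norm_mul, Real.mul_rpow (norm_nonneg _) (norm_nonneg _),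
    Real.norm_of_nonneg ht.le, Real.norm_eq_abs]
  ring

/-! ### Second differences of the norm of a row -/

section Row

variable {q : ℝ≥0∞} [Fact (1 ≤ q)]

theorem secondDiff_zero_smul {E : Type*} [NormedAddCommGroup E] [NormedSpace ℝ E] {r t : ℝ}
    (hr : 0 < r) (ht : 0 < t) (w : E) : secondDiff r 0 (t • w) = 2 * ‖w‖ ^ r * t ^ r := by
  rw [secondDiff_zero_left hr, norm_smul, Real.mul_rpow (norm_nonneg _) (norm_nonneg _),
    Real.norm_of_nonneg ht.le]
  ring

theorem secondDiff_smul_single (hq : 0 < q.toReal) (u : lp (fun _ : ℕ => ℝ) q) (j : ℕ) (t : ℝ) :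
    secondDiff q.toReal u (t • lp.single q j (1 : ℝ)) = secondDiff q.toReal (u j) (t * 1) := by
  rw [← lp.single_smul, secondDiff_single hq, smul_eq_mul]

/-- In a direction moving only a vanishing coordinate, the second difference has the order
`t ^ q` of the coordinate itself. -/
theorem secondDiff_smul_single_le_rpow {a : ℝ} (ha : 0 ≤ a) (haq : a ≤ q.toReal)
    (hq : 0 < q.toReal) {u : lp (fun _ : ℕ => ℝ) q} (hu : u ≠ 0) {j : ℕ} (huj : u j = 0) :
    ∃ C : ℝ, ∀ᶠ t in 𝓝[>] (0 : ℝ),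
      secondDiff a u (t • lp.single q j (1 : ℝ)) ≤ C * t ^ q.toReal := by
  refine ⟨a / q.toReal * ‖u‖ ^ (a - q.toReal) * 2, ?_⟩
  filter_upwards [self_mem_nhdsWithin] with t ht
  have h := secondDiff_le_of_le ha hq haq hu (t • lp.single q j (1 : ℝ))
  rw [secondDiff_smul_single hq, huj, secondDiff_real_zero hq ht] at h
  simpa [mul_assoc] using h

theorem secondDiff_smul_single_le_sq {a : ℝ} (ha : 0 ≤ a) (haq : a ≤ q.toReal)
    (hq : 2 ≤ q.toReal) {u : lp (fun _ : ℕ => ℝ) q} (hu : u ≠ 0) (j : ℕ) :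
    ∃ C : ℝ, ∀ᶠ t in 𝓝[>] (0 : ℝ),
      secondDiff a u (t • lp.single q j (1 : ℝ)) ≤ C * t ^ (2 : ℝ) := by
  have hq0 : 0 < q.toReal := by linarith
  have hM : 0 ≤ a / q.toReal * ‖u‖ ^ (a - q.toReal) := by positivity
  by_cases huj : u j = 0
  · refine ⟨a / q.toReal * ‖u‖ ^ (a - q.toReal) * 2, ?_⟩
    filter_upwards [Ioc_mem_nhdsGT (zero_lt_one' ℝ)] with t ht
    have h := secondDiff_le_of_le ha hq0 haq hu (t • lp.single q j (1 : ℝ))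
    rw [secondDiff_smul_single hq0, huj, secondDiff_real_zero hq0 ht.1] at h
    refine h.trans ?_
    rw [abs_one, Real.one_rpow, mul_one, ← mul_assoc]
    exact mul_le_mul_of_nonneg_left (Real.rpow_le_rpow_of_exponent_ge ht.1 ht.2 hq) (by positivity)
  · obtain ⟨C, hC⟩ := exists_eventually_le_of_tendsto_div
      (tendsto_secondDiff_real (r := q.toReal) huj 1)
    refine ⟨a / q.toReal * ‖u‖ ^ (a - q.toReal) * C, ?_⟩
    filter_upwards [hC] with t ht
    have h := secondDiff_le_of_le ha hq0 haq hu (t • lp.single q j (1 : ℝ))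
    rw [secondDiff_smul_single hq0] at h
    refine h.trans ?_
    rw [mul_assoc (_ * _)]
    exact mul_le_mul_of_nonneg_left ht hM

/-- The norm is twice differentiable in a direction moving only a nonvanishing coordinate, whatever
the exponents. -/
theorem secondDiff_smul_single_le_sq_of_ne {a : ℝ} (hq : 0 < q.toReal)
    {u : lp (fun _ : ℕ => ℝ) q} {j : ℕ} (huj : u j ≠ 0) :
    ∃ C : ℝ, ∀ᶠ t in 𝓝[>] (0 : ℝ),
      secondDiff a u (t • lp.single q j (1 : ℝ)) ≤ C * t ^ (2 : ℝ) := by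
  wlog hpos : 0 < u j generalizing u
  · have := this (u := -u) (neg_ne_zero.2 huj)
      (neg_pos.2 (lt_of_le_of_ne (not_lt.1 hpos) huj))
    simpa only [secondDiff_neg_left] using this
  set s := q.toReal with hs
  set b := u j with hb
  -- the contribution of the other coordinates to the `q`-th power of the norm
  set c := ‖u‖ ^ s - b ^ s with hc
  have hc0 : 0 ≤ c := by
    have := Real.rpow_le_rpow (norm_nonneg _)
      (lp.norm_apply_le_norm (p := q) (fun h => by simp [hs, h] at hq) u j) hq.le
    rw [Real.norm_of_nonneg hpos.le] at this
    linarith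
  have hnorm : ∀ t : ℝ, 0 < b + t → ‖u + t • lp.single q j (1 : ℝ)‖ ^ s = c + (b + t) ^ s := by
    intro t ht
    have hx : ∀ i, (u + t • (lp.single q j 1 : lp (fun _ : ℕ => ℝ) q)) i
        = u i + t * (lp.single q j 1 : lp (fun _ : ℕ => ℝ) q) i := fun i => rfl
    generalize u + t • (lp.single q j 1 : lp (fun _ : ℕ => ℝ) q) = x at hx ⊢
    have hdiff := hasSum_single (f := fun i => ‖x i‖ ^ s - ‖u i‖ ^ s) j fun i hi => by
      rw [hx, lp.single_apply_ne q j _ hi, mul_zero, add_zero, sub_self]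
    have h := ((lp.hasSum_norm hq x).sub (lp.hasSum_norm hq u)).unique hdiff
    rw [hx, lp.single_apply_self, mul_one, ← hb, Real.norm_of_nonneg hpos.le,
      Real.norm_of_nonneg ht.le] at h
    linarith
  set g : ℝ → ℝ := fun t => c + (b + t) ^ s with hg
  have hgpos : ∀ t, 0 < b + t → 0 < g t := fun t ht =>
    add_pos_of_nonneg_of_pos hc0 (Real.rpow_pos_of_pos ht s)
  have hlin : ∀ t, HasDerivAt (fun t : ℝ => b + t) 1 t := fun t => (hasDerivAt_id t).const_add b
  have hpow : ∀ e t, 0 < b + t →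
      HasDerivAt (fun t : ℝ => (b + t) ^ e) (1 * e * (b + t) ^ (e - 1)) t :=
    fun e t ht => (hlin t).rpow_const (Or.inl ht.ne')
  have hgd : ∀ t, 0 < b + t → HasDerivAt g (1 * s * (b + t) ^ (s - 1)) t :=
    fun t ht => (hpow s t ht).const_add c
  have hgr : ∀ e t, 0 < b + t →
      HasDerivAt (fun t => g t ^ e) (1 * s * (b + t) ^ (s - 1) * e * g t ^ (e - 1)) t :=
    fun e t ht => (hgd t ht).rpow_const (Or.inl (hgpos t ht).ne')
  have hnear : ∀ᶠ t in 𝓝 (0 : ℝ), 0 < b + t := by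
    have : ContinuousAt (fun t : ℝ => b + t) 0 := by fun_prop
    exact this.eventually (lt_mem_nhds (by simpa using hpos))
  have h0 : 0 < b + 0 := by simpa using hpos
  have hlim := tendsto_symm_second_diff (hnear.mono fun t ht => hgr (a / s) t ht)
    ((((hpow (s - 1) 0 h0).const_mul (1 * s)).mul_const (a / s)).mul (hgr (a / s - 1) 0 h0))
  obtain ⟨C, hC⟩ := exists_eventually_le_of_tendsto_div hlim
  refine ⟨C, ?_⟩
  filter_upwards [hC, nhdsWithin_le_nhds (hnear.and
    (((continuous_neg (G := ℝ)).tendsto' 0 0 neg_zero).eventually hnear))] with t ht hnt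
  have hr : ∀ t, 0 < b + t → ‖u + t • lp.single q j (1 : ℝ)‖ ^ a = g t ^ (a / s) := by
    intro t ht
    simp only [hg]
    rw [← hnorm t ht, ← Real.rpow_mul (norm_nonneg _), mul_div_cancel₀ _ hq.ne']
  have e0 := hr 0 h0
  rw [zero_smul, add_zero] at e0
  have e1 := hr t hnt.1
  have e2 := hr (-t) hnt.2
  rw [neg_smul, ← sub_eq_add_neg] at e2
  rw [secondDiff, e0, e1, e2]
  exact ht

theorem sq_le_secondDiff_smul_of_lt {a : ℝ} (ha : 1 < a) (haq : a < q.toReal)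
    {u w : lp (fun _ : ℕ => ℝ) q} {j : ℕ} (huj : u j ≠ 0) (hwj : w j ≠ 0) :
    ∃ c : ℝ, 0 < c ∧ ∀ᶠ t in 𝓝[>] (0 : ℝ), c * t ^ (2 : ℝ) ≤ secondDiff a u (t • w) := by
  have hu : u ≠ 0 := fun h => huj (by rw [h]; rfl)
  have hM : 0 < ‖u‖ ^ (q.toReal - a) := Real.rpow_pos_of_pos (norm_pos_iff.2 hu) _
  have hm : 0 < ‖u j‖ ^ (q.toReal - a) := Real.rpow_pos_of_pos (norm_pos_iff.2 huj) _
  have hd : 0 < a * (a - 1) * |u j| ^ (a - 2) * w j ^ 2 := by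
    have := Real.rpow_pos_of_pos (abs_pos.2 huj) (a - 2)
    have : 0 < a - 1 := by linarith
    positivity
  obtain ⟨c, hc, hlow⟩ := exists_eventually_ge_of_tendsto_div hd
    (tendsto_secondDiff_real (r := a) huj (w j))
  refine ⟨‖u j‖ ^ (q.toReal - a) * c / ‖u‖ ^ (q.toReal - a), by positivity, ?_⟩
  filter_upwards [hlow] with t ht
  have h := mul_secondDiff_apply_le ha.le haq u (t • w) j
  rw [div_mul_eq_mul_div, div_le_iff₀ hM, mul_comm (secondDiff a u _), mul_assoc]
  exact (mul_le_mul_of_nonneg_left ht hm.le).trans h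

/-- A vanishing coordinate of `u` moved by `w` makes the second difference as large as
`t ^ q`. -/
theorem rpow_le_secondDiff_smul {a : ℝ} (hq : 1 ≤ q.toReal) (hqa : q.toReal ≤ a)
    {u w : lp (fun _ : ℕ => ℝ) q} (hu : u ≠ 0) {j : ℕ} (huj : u j = 0) (hwj : w j ≠ 0) :
    ∃ c : ℝ, 0 < c ∧ ∀ᶠ t in 𝓝[>] (0 : ℝ), c * t ^ q.toReal ≤ secondDiff a u (t • w) := by
  have hq0 : 0 < q.toReal := by linarith
  have hM : 0 < a / q.toReal * ‖u‖ ^ (a - q.toReal) :=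
    mul_pos (div_pos (by linarith) hq0) (Real.rpow_pos_of_pos (norm_pos_iff.2 hu) _)
  have hw : 0 < |w j| ^ q.toReal := Real.rpow_pos_of_pos (abs_pos.2 hwj) _
  refine ⟨a / q.toReal * ‖u‖ ^ (a - q.toReal) * (2 * |w j| ^ q.toReal), by positivity, ?_⟩
  filter_upwards [self_mem_nhdsWithin] with t ht
  have h1 := le_secondDiff_of_le hq0 hqa hu (t • w)
  have h2 : secondDiff q.toReal (u j) (t * w j) ≤ _ := secondDiff_apply_le hq u (t • w) j
  rw [huj, secondDiff_real_zero hq0 ht] at h2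
  rw [mul_assoc (_ * _)]
  exact (mul_le_mul_of_nonneg_left h2 hM.le).trans h1

theorem sq_le_secondDiff_smul_of_ge {a : ℝ} (hq : 1 < q.toReal) (hq2 : q.toReal ≤ 2)
    (hqa : q.toReal ≤ a) {u w : lp (fun _ : ℕ => ℝ) q} (hu : u ≠ 0) (hw : w ≠ 0) :
    ∃ c : ℝ, 0 < c ∧ ∀ᶠ t in 𝓝[>] (0 : ℝ), c * t ^ (2 : ℝ) ≤ secondDiff a u (t • w) := by
  have hq0 : 0 < q.toReal := by linarith
  obtain ⟨j, hwj⟩ : ∃ j, w j ≠ 0 := by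
    by_contra! h
    exact hw (lp.ext (funext h))
  by_cases huj : u j = 0
  · obtain ⟨c, hc, h⟩ := rpow_le_secondDiff_smul hq.le hqa hu huj hwj
    refine ⟨c, hc, ?_⟩
    filter_upwards [h, Ioc_mem_nhdsGT (zero_lt_one' ℝ)] with t h1 ht
    exact (mul_le_mul_of_nonneg_left
      (Real.rpow_le_rpow_of_exponent_ge ht.1 ht.2 hq2) hc.le).trans h1
  · have hM : 0 < a / q.toReal * ‖u‖ ^ (a - q.toReal) :=
      mul_pos (div_pos (by linarith) hq0) (Real.rpow_pos_of_pos (norm_pos_iff.2 hu) _)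
    have hd : 0 < q.toReal * (q.toReal - 1) * |u j| ^ (q.toReal - 2) * w j ^ 2 := by
      have := Real.rpow_pos_of_pos (abs_pos.2 huj) (q.toReal - 2)
      have : 0 < q.toReal - 1 := by linarith
      positivity
    obtain ⟨c, hc, hlow⟩ := exists_eventually_ge_of_tendsto_div hd
      (tendsto_secondDiff_real (r := q.toReal) huj (w j))
    refine ⟨a / q.toReal * ‖u‖ ^ (a - q.toReal) * c, mul_pos hM hc, ?_⟩
    filter_upwards [hlow] with t ht
    have h1 := le_secondDiff_of_le hq0 hqa hu (t • w)
    have h2 : secondDiff q.toReal (u j) (t * w j) ≤ _ := secondDiff_apply_le hq.le u (t • w) j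
    rw [mul_assoc (_ * _)]
    exact (mul_le_mul_of_nonneg_left (ht.trans h2) hM.le).trans h1

end Row

/-! ### Coordinates, restrictions and domination -/

section Domination

variable {ι : Type*} {E : ι → Type*} [∀ i, NormedAddCommGroup (E i)] {r : ℝ≥0∞}

/-- Strict monotonicity of the norm of `ℓ_r`. -/
theorem norm_apply_eq_of_norm_le (hr : 0 < r.toReal) {f g : lp E r}
    (hfg : ∀ i, ‖f i‖ ≤ ‖g i‖) (hgf : ‖g‖ ≤ ‖f‖) (i : ι) : ‖f i‖ = ‖g i‖ := by
  by_contra hne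
  have hlt : ‖f i‖ ^ r.toReal < ‖g i‖ ^ r.toReal :=
    Real.rpow_lt_rpow (norm_nonneg _) (lt_of_le_of_ne (hfg i) hne) hr
  have h := hasSum_lt (fun j => Real.rpow_le_rpow (norm_nonneg _) (hfg j) hr.le) hlt
    (lp.hasSum_norm hr f) (lp.hasSum_norm hr g)
  exact absurd (Real.rpow_le_rpow (lp.norm_nonneg' g) hgf hr.le) (not_le.2 h)

/-- Dominated convergence in `ℓ_r`. -/
theorem tendsto_lp_of_dominated [Fact (1 ≤ r)] (hr : r ≠ ∞) {α : Type*} {l : Filter α}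
    {F : α → lp E r} {f g : lp E r} (hF : ∀ a i, ‖F a i‖ ≤ ‖g i‖) (hf : ∀ i, ‖f i‖ ≤ ‖g i‖)
    (hlim : ∀ i, Tendsto (fun a => F a i) l (𝓝 (f i))) : Tendsto F l (𝓝 f) := by
  have hr0 : 0 < r.toReal := ENNReal.toReal_pos (zero_lt_one.trans_le Fact.out).ne' hr
  rw [tendsto_iff_norm_sub_tendsto_zero]
  have hsum : Summable fun i => (2 * ‖g i‖) ^ r.toReal := by
    simp only [Real.mul_rpow zero_le_two (norm_nonneg _)]
    exact ((lp.memℓp g).summable hr0).mul_left _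
  have h := tendsto_tsum_of_dominated_convergence (𝓕 := l)
    (f := fun a i => ‖F a i - f i‖ ^ r.toReal) (g := fun _ => (0 : ℝ)) hsum
    (fun i => by
      have h1 := (tendsto_iff_norm_sub_tendsto_zero.1 (hlim i)).rpow_const (Or.inr hr0.le)
      rwa [Real.zero_rpow hr0.ne'] at h1)
    (Eventually.of_forall fun a i => by
      rw [Real.norm_of_nonneg (by positivity)]
      refine Real.rpow_le_rpow (norm_nonneg _) ((norm_sub_le _ _).trans ?_) hr0.le
      linarith [hF a i, hf i])
  rw [tsum_zero] at h
  have h2 := h.rpow_const (p := 1 / r.toReal) (Or.inr (by positivity))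
  rw [Real.zero_rpow (by positivity)] at h2
  refine h2.congr fun a => ?_
  rw [lp.norm_eq_tsum_rpow hr0]
  rfl

end Domination

section Restrict

variable {p q : ℝ≥0∞} [Fact (1 ≤ q)]

theorem ext_coord {x y : EllPEllQ p q} (h : ∀ i : ℕ × ℕ, x i.1 i.2 = y i.1 i.2) : x = y :=
  lp.ext (funext fun k => lp.ext (funext fun j => h (k, j)))

open Classical in
/-- The restriction of `x` to a set `S` of coordinates, the other coordinates being set to `0`. -/
noncomputable def restrict (S : Set (ℕ × ℕ)) (x : EllPEllQ p q) : EllPEllQ p q :=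
  have hrow : ∀ k j, ‖if (k, j) ∈ S then x k j else 0‖ ≤ ‖x k j‖ := fun k j => by
    split_ifs <;> simp
  have hmem : ∀ k, Memℓp (fun j => if (k, j) ∈ S then x k j else 0) q := fun k =>
    (lp.memℓp (x k)).mono' (hrow k)
  ⟨fun k => ⟨fun j => if (k, j) ∈ S then x k j else 0, hmem k⟩, (lp.memℓp x).mono' fun k =>
    lp.norm_mono (zero_lt_one.trans_le Fact.out).ne' (hrow k)⟩

theorem restrict_apply_of_mem {S : Set (ℕ × ℕ)} {i : ℕ × ℕ} (hi : i ∈ S) (x : EllPEllQ p q) :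
    restrict S x i.1 i.2 = x i.1 i.2 := if_pos hi

theorem restrict_apply_of_notMem {S : Set (ℕ × ℕ)} {i : ℕ × ℕ} (hi : i ∉ S) (x : EllPEllQ p q) :
    restrict S x i.1 i.2 = 0 := if_neg hi

theorem norm_restrict_apply_le (S : Set (ℕ × ℕ)) (x : EllPEllQ p q) (i : ℕ × ℕ) :
    ‖restrict S x i.1 i.2‖ ≤ ‖x i.1 i.2‖ := by
  by_cases hi : i ∈ S
  · rw [restrict_apply_of_mem hi]
  · rw [restrict_apply_of_notMem hi, norm_zero]
    exact norm_nonneg _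

/-- The coordinates in the rows where `x` does not vanish. -/
def rowSupp (x : EllPEllQ p q) : Set (ℕ × ℕ) := {i | x i.1 ≠ 0}

theorem supp_subset_rowSupp (x : EllPEllQ p q) : supp x ⊆ rowSupp x :=
  fun i hi h => hi (by rw [h]; rfl)

theorem restrict_add_restrict_compl (S : Set (ℕ × ℕ)) (x : EllPEllQ p q) :
    restrict S x + restrict Sᶜ x = x := by
  refine ext_coord fun i => ?_
  change restrict S x i.1 i.2 + restrict Sᶜ x i.1 i.2 = _
  by_cases hi : i ∈ S
  · rw [restrict_apply_of_mem hi, restrict_apply_of_notMem (not_not.2 hi), add_zero]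
  · rw [restrict_apply_of_notMem hi, restrict_apply_of_mem (S := Sᶜ) hi, zero_add]

variable [Fact (1 ≤ p)]

variable (p q) in
/-- The coordinate functionals of the canonical basis. -/
noncomputable def coord (i : ℕ × ℕ) : EllPEllQ p q →L[ℝ] ℝ :=
  (lp.evalCLM ℝ (fun _ : ℕ => ℝ) q i.2).comp
    (lp.evalCLM ℝ (fun _ : ℕ => lp (fun _ : ℕ => ℝ) q) p i.1)

theorem coord_apply (i : ℕ × ℕ) (x : EllPEllQ p q) : coord p q i x = x i.1 i.2 := rfl

/-- A vector is determined by its restriction to `S` if its norm is carried by `S`. -/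
theorem eq_restrict_of_norm_le (hp : p ≠ ∞) (hq : q ≠ ∞) {S : Set (ℕ × ℕ)} {x : EllPEllQ p q}
    (h : ‖x‖ ≤ ‖restrict S x‖) : x = restrict S x := by
  have hp0 : 0 < p.toReal := ENNReal.toReal_pos (zero_lt_one.trans_le Fact.out).ne' hp
  have hq' : q ≠ 0 := (zero_lt_one.trans_le Fact.out).ne'
  have hq0 : 0 < q.toReal := ENNReal.toReal_pos hq' hq
  refine ext_coord fun i => ?_
  by_cases hi : i ∈ S
  · rw [restrict_apply_of_mem hi]
  · have hle : ∀ k j, ‖restrict S x k j‖ ≤ ‖x k j‖ := fun k j => norm_restrict_apply_le S x (k, j)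
    have h1 := norm_apply_eq_of_norm_le hp0 (fun k => lp.norm_mono hq' (hle k)) h i.1
    have h2 := norm_apply_eq_of_norm_le hq0 (hle i.1) h1.ge i.2
    rw [restrict_apply_of_notMem hi] at h2 ⊢
    exact norm_eq_zero.1 (h2.symm.trans norm_zero)

theorem tendsto_of_dominated (hp : p ≠ ∞) (hq : q ≠ ∞) {α : Type*} {l : Filter α}
    {F : α → EllPEllQ p q} {f g : EllPEllQ p q}
    (hF : ∀ a (i : ℕ × ℕ), ‖F a i.1 i.2‖ ≤ ‖g i.1 i.2‖)
    (hf : ∀ i : ℕ × ℕ, ‖f i.1 i.2‖ ≤ ‖g i.1 i.2‖)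
    (hlim : ∀ i : ℕ × ℕ, Tendsto (fun a => F a i.1 i.2) l (𝓝 (f i.1 i.2))) :
    Tendsto F l (𝓝 f) := by
  have hq' : q ≠ 0 := (zero_lt_one.trans_le Fact.out).ne'
  exact tendsto_lp_of_dominated hp (fun a k => lp.norm_mono hq' fun j => hF a (k, j))
    (fun k => lp.norm_mono hq' fun j => hf (k, j)) fun k =>
      tendsto_lp_of_dominated hq (fun a j => hF a (k, j)) (fun j => hf (k, j))
        fun j => hlim (k, j)

variable (p q) in
/-- The canonical basis vector `e_{kj}`, for `i = (k, j)`. -/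
noncomputable def unitVec (i : ℕ × ℕ) : EllPEllQ p q :=
  lp.single p i.1 (lp.single q i.2 (1 : ℝ))

theorem apply_eq_zero_of_unitVec (hp : p ≠ ∞) (hq : q ≠ ∞) (φ : EllPEllQ p q →L[ℝ] ℝ)
    {S : Set (ℕ × ℕ)} (hφ : ∀ i ∈ S, φ (unitVec p q i) = 0) {x : EllPEllQ p q}
    (hx : ∀ i ∉ S, x i.1 i.2 = 0) : φ x = 0 := by
  have hrow : ∀ k, φ (lp.single p k (x k)) = 0 := by
    intro k
    have h := (((lp.hasSum_single hq (x k)).mapL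
      (lp.singleContinuousLinearMap ℝ (fun _ : ℕ => lp (fun _ : ℕ => ℝ) q) p k))).mapL φ
    refine h.unique (hasSum_zero.congr_fun fun j => ?_)
    have e : lp.single q j (x k j) = x k j • (lp.single q j 1 : lp (fun _ : ℕ => ℝ) q) := by
      rw [← lp.single_smul, smul_eq_mul, mul_one]
    rw [e, map_smul, map_smul]
    by_cases hj : (k, j) ∈ S
    · exact smul_eq_zero_of_right _ (hφ _ hj)
    · exact smul_eq_zero_of_left (hx _ hj) _
  exact ((lp.hasSum_single hp x).mapL φ).unique (hasSum_zero.congr_fun hrow)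

end Restrict

/-! ### Coordinate subspaces invariant under a contractive projection -/

section Projection

variable {p q : ℝ≥0∞} [Fact (1 ≤ p)] [Fact (1 ≤ q)] {P : EllPEllQ p q →L[ℝ] EllPEllQ p q}

/-- If `P` leaves the vectors supported in `S` invariant, then for `P y = y` the image of the
restriction `z` of `y` to `Sᶜ` agrees with `z` on `Sᶜ`; being no longer than `z`, it is `z`. -/
theorem IsContractiveProjection.apply_restrict_compl (hP : IsContractiveProjection P)
    (hp : p ≠ ∞) (hq : q ≠ ∞) {S : Set (ℕ × ℕ)}
    (hS : ∀ i ∈ S, ∀ j ∉ S, P (unitVec p q i) j.1 j.2 = 0) {y : EllPEllQ p q} (hy : P y = y) :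
    P (restrict Sᶜ y) = restrict Sᶜ y := by
  have hinv : ∀ j ∉ S, P (restrict S y) j.1 j.2 = 0 := fun j hj =>
    apply_eq_zero_of_unitVec hp hq ((coord p q j).comp P) (fun i hi => hS i hi j hj)
      fun i hi => restrict_apply_of_notMem hi y
  have hsum : P (restrict S y) + P (restrict Sᶜ y) = y := by
    rw [← map_add, restrict_add_restrict_compl, hy]
  have hres : restrict Sᶜ (P (restrict Sᶜ y)) = restrict Sᶜ y := by
    refine ext_coord fun j => ?_
    by_cases hj : j ∈ S
    · rw [restrict_apply_of_notMem (not_not.2 hj), restrict_apply_of_notMem (not_not.2 hj)]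
    · rw [restrict_apply_of_mem (S := Sᶜ) hj, restrict_apply_of_mem (S := Sᶜ) hj]
      have h : P (restrict S y) j.1 j.2 + P (restrict Sᶜ y) j.1 j.2 = y j.1 j.2 :=
        congrArg (fun z : EllPEllQ p q => z j.1 j.2) hsum
      rwa [hinv j hj, zero_add] at h
  have h := eq_restrict_of_norm_le hp hq (S := Sᶜ) (x := P (restrict Sᶜ y))
    (by rw [hres]; exact hP.contractive _)
  rwa [hres] at h

/-- Moving a fixed point `x` in the direction `P z` changes the norm no more than moving it in the
direction `z`. The second difference in a coordinate direction involves a single row only. -/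
theorem IsContractiveProjection.secondDiff_row_le (hP : IsContractiveProjection P)
    (hp : 1 ≤ p.toReal) {x : EllPEllQ p q} (hx : P x = x) (i : ℕ × ℕ) (k : ℕ) (t : ℝ) :
    secondDiff p.toReal (x k) (t • P (unitVec p q i) k)
      ≤ secondDiff p.toReal (x i.1) (t • lp.single q i.2 (1 : ℝ)) := by
  have hp0 : 0 < p.toReal := by linarith
  have hmono : secondDiff p.toReal x (t • P (unitVec p q i))
      ≤ secondDiff p.toReal x (t • unitVec p q i) := by
    have h1 := hP.contractive (x + t • unitVec p q i)
    have h2 := hP.contractive (x - t • unitVec p q i)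
    rw [map_add, map_smul, hx] at h1
    rw [map_sub, map_smul, hx] at h2
    have h3 := Real.rpow_le_rpow (norm_nonneg _) h1 hp0.le
    have h4 := Real.rpow_le_rpow (norm_nonneg _) h2 hp0.le
    unfold secondDiff
    linarith
  refine (secondDiff_apply_le hp x (t • P (unitVec p q i)) k).trans (hmono.trans (le_of_eq ?_))
  rw [unitVec, ← lp.single_smul, secondDiff_single hp0]

theorem IsContractiveProjection.apply_unitVec_of_lt (hP : IsContractiveProjection P)
    (hp1 : 1 < p.toReal) (hp2 : p.toReal < 2) (hq2 : 2 < q.toReal) {x : EllPEllQ p q}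
    (hx : P x = x) :
    (∀ i ∈ rowSupp x, ∀ j ∉ rowSupp x, P (unitVec p q i) j.1 j.2 = 0) ∧
      (∀ i ∈ rowSupp x \ supp x, ∀ j ∉ rowSupp x \ supp x, P (unitVec p q i) j.1 j.2 = 0) := by
  have hrow : ∀ i ∈ rowSupp x, ∀ j ∉ rowSupp x, P (unitVec p q i) j.1 j.2 = 0 := by
    intro i hi j hj
    have hxj : x j.1 = 0 := not_not.1 hj
    by_contra hne
    have hw : 0 < ‖P (unitVec p q i) j.1‖ := norm_pos_iff.2 fun h => hne (by rw [h]; rfl)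
    obtain ⟨C, hC⟩ := secondDiff_smul_single_le_sq (a := p.toReal) (by linarith) (by linarith)
      hq2.le (show x i.1 ≠ 0 from hi) i.2
    refine not_eventually_mul_rpow_le (c := 2 * ‖P (unitVec p q i) j.1‖ ^ p.toReal) (C := C) hp2
      (by positivity) ?_
    filter_upwards [hC, self_mem_nhdsWithin] with t ht ht0
    have h := hP.secondDiff_row_le hp1.le hx i j.1 t
    rw [hxj, secondDiff_zero_smul (by linarith) ht0] at h
    exact h.trans ht
  refine ⟨hrow, fun i hi j hj => ?_⟩
  by_cases hjr : j ∈ rowSupp x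
  swap
  · exact hrow i hi.1 j hjr
  by_contra hne
  have hxj : x j.1 j.2 ≠ 0 := by
    by_contra h
    exact hj ⟨hjr, fun h' => h' h⟩
  obtain ⟨C, hC⟩ := secondDiff_smul_single_le_rpow (a := p.toReal) (by linarith) (by linarith)
    (by linarith) (show x i.1 ≠ 0 from hi.1) (not_not.1 hi.2 : x i.1 i.2 = 0)
  obtain ⟨c, hc, hlow⟩ := sq_le_secondDiff_smul_of_lt hp1 (by linarith) hxj hne
  refine not_eventually_mul_rpow_le (c := c) (C := C) hq2 hc ?_
  filter_upwards [hC, hlow] with t h1 h2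
  exact h2.trans ((hP.secondDiff_row_le hp1.le hx i j.1 t).trans h1)

theorem IsContractiveProjection.apply_unitVec_of_gt (hP : IsContractiveProjection P)
    (hp2 : 2 < p.toReal) (hq1 : 1 < q.toReal) (hq2 : q.toReal < 2) {x : EllPEllQ p q}
    (hx : P x = x) :
    (∀ i ∈ (rowSupp x)ᶜ, ∀ j ∉ (rowSupp x)ᶜ, P (unitVec p q i) j.1 j.2 = 0) ∧
      (∀ i ∈ (rowSupp x \ supp x)ᶜ, ∀ j ∉ (rowSupp x \ supp x)ᶜ,
        P (unitVec p q i) j.1 j.2 = 0) := by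
  have hrow : ∀ i ∈ (rowSupp x)ᶜ, ∀ j ∉ (rowSupp x)ᶜ, P (unitVec p q i) j.1 j.2 = 0 := by
    intro i hi j hj
    have hxi : x i.1 = 0 := not_not.1 hi
    have hxj : x j.1 ≠ 0 := not_not.1 hj
    by_contra hne
    obtain ⟨c, hc, hlow⟩ := sq_le_secondDiff_smul_of_ge (a := p.toReal) hq1 hq2.le (by linarith)
      hxj (w := P (unitVec p q i) j.1) fun h => hne (by rw [h]; rfl)
    refine not_eventually_mul_rpow_le (c := c) (C := 2 * ‖(lp.single q i.2 1 :
      lp (fun _ : ℕ => ℝ) q)‖ ^ p.toReal) hp2 hc ?_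
    filter_upwards [hlow, self_mem_nhdsWithin] with t h1 ht0
    have h := hP.secondDiff_row_le (by linarith) hx i j.1 t
    rw [hxi, secondDiff_zero_smul (by linarith) ht0] at h
    exact h1.trans h
  refine ⟨hrow, fun i hi j hj => ?_⟩
  have hj' : j ∈ rowSupp x \ supp x := not_not.1 hj
  by_cases hir : i ∈ rowSupp x
  swap
  · exact hrow i hir j (not_not.2 hj'.1)
  by_contra hne
  have hxi : x i.1 i.2 ≠ 0 := by
    by_contra h
    exact hi ⟨hir, fun h' => h' h⟩
  obtain ⟨C, hC⟩ := secondDiff_smul_single_le_sq_of_ne (a := p.toReal) (by linarith) hxi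
  obtain ⟨c, hc, hlow⟩ := rpow_le_secondDiff_smul (a := p.toReal) hq1.le (by linarith)
    (show x j.1 ≠ 0 from hj'.1) (not_not.1 hj'.2 : x j.1 j.2 = 0) hne
  refine not_eventually_mul_rpow_le (c := c) (C := C) hq2 hc ?_
  filter_upwards [hC, hlow] with t h1 h2
  exact h2.trans ((hP.secondDiff_row_le (by linarith) hx i j.1 t).trans h1)

theorem IsContractiveProjection.apply_restrict_supp (hP : IsContractiveProjection P)
    (hpq : (1 < p ∧ p < 2 ∧ 2 < q ∧ q < ∞) ∨ (2 < p ∧ p < ∞ ∧ 1 < q ∧ q < 2))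
    {x y : EllPEllQ p q} (hx : P x = x) (hy : P y = y) :
    P (restrict (supp x) y) = restrict (supp x) y := by
  have hp : p ≠ ∞ := by
    rcases hpq with ⟨-, h, -⟩ | ⟨-, h, -⟩
    exacts [(h.trans ENNReal.ofNat_lt_top).ne, h.ne]
  have hq : q ≠ ∞ := by
    rcases hpq with ⟨-, -, -, h⟩ | ⟨-, -, -, h⟩
    exacts [h.ne, (h.trans ENNReal.ofNat_lt_top).ne]
  have one_lt : ∀ {a : ℝ≥0∞}, a ≠ ∞ → 1 < a → 1 < a.toReal := fun ha h => by
    simpa using (ENNReal.toReal_lt_toReal ENNReal.one_ne_top ha).2 h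
  have two_lt : ∀ {a : ℝ≥0∞}, a ≠ ∞ → 2 < a → 2 < a.toReal := fun ha h => by
    simpa using (ENNReal.toReal_lt_toReal ENNReal.ofNat_ne_top ha).2 h
  have lt_two : ∀ {a : ℝ≥0∞}, a ≠ ∞ → a < 2 → a.toReal < 2 := fun ha h => by
    simpa using (ENNReal.toReal_lt_toReal ha ENNReal.ofNat_ne_top).2 h
  -- either a set or its complement may be invariant: both restrictions of `y` are then fixed
  have hcompl : ∀ {S : Set (ℕ × ℕ)} {z : EllPEllQ p q}, P z = z →
      P (restrict S z) = restrict S z → P (restrict Sᶜ z) = restrict Sᶜ z := fun {S z} hz hS => by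
    rw [eq_sub_of_add_eq' (restrict_add_restrict_compl S z), map_sub, hz, hS]
  have hmain : ∀ z : EllPEllQ p q, P z = z →
      P (restrict (rowSupp x) z) = restrict (rowSupp x) z ∧
      P (restrict (rowSupp x \ supp x)ᶜ z) = restrict (rowSupp x \ supp x)ᶜ z := by
    intro z hz
    rcases hpq with ⟨h1, h2, h3, -⟩ | ⟨h1, -, h3, h4⟩
    · have h := hP.apply_unitVec_of_lt (one_lt hp h1) (lt_two hp h2) (two_lt hq h3) hx
      have h5 := hcompl hz (hP.apply_restrict_compl hp hq h.1 hz)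
      rw [compl_compl] at h5
      exact ⟨h5, hP.apply_restrict_compl hp hq h.2 hz⟩
    · have h := hP.apply_unitVec_of_gt (two_lt hp h1) (one_lt hq h3) (lt_two hq h4) hx
      have h5 := hP.apply_restrict_compl hp hq h.1 hz
      rw [compl_compl] at h5
      have h6 := hP.apply_restrict_compl hp hq h.2 hz
      exact ⟨h5, hcompl hz (by rwa [compl_compl] at h6)⟩
  have heq : restrict (rowSupp x \ supp x)ᶜ (restrict (rowSupp x) y) = restrict (supp x) y := by
    refine ext_coord fun i => ?_
    by_cases hi : i ∈ supp x
    · rw [restrict_apply_of_mem (show i ∈ (rowSupp x \ supp x)ᶜ from fun h => h.2 hi),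
        restrict_apply_of_mem (supp_subset_rowSupp x hi), restrict_apply_of_mem hi]
    · rw [restrict_apply_of_notMem hi]
      by_cases hir : i ∈ rowSupp x
      · exact restrict_apply_of_notMem (not_not.2 ⟨hir, hi⟩) _
      · rw [restrict_apply_of_mem (show i ∈ (rowSupp x \ supp x)ᶜ from fun h => hir h.1),
          restrict_apply_of_notMem hir]
  rw [← heq]
  exact (hmain _ (hmain y hy).1).2

end Projection

/-! ### Block bases of subspaces closed under restriction to supports -/

section Basis

variable {p q : ℝ≥0∞} [Fact (1 ≤ q)] {Y : Submodule ℝ (EllPEllQ p q)}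

/-- Two coordinates are linked by `Y` if each element of `Y` vanishes at both or at none. -/
def Linked (Y : Submodule ℝ (EllPEllQ p q)) (i j : ℕ × ℕ) : Prop :=
  ∀ z ∈ Y, z i.1 i.2 = 0 ↔ z j.1 j.2 = 0

theorem exists_ne_zero_eq_zero_of_not_linked
    (h : ∀ x ∈ Y, ∀ y ∈ Y, restrict (supp x) y ∈ Y) {i j : ℕ × ℕ}
    (hi : ∃ v ∈ Y, v i.1 i.2 ≠ 0) (hij : ¬ Linked Y i j) :
    ∃ v ∈ Y, v i.1 i.2 ≠ 0 ∧ v j.1 j.2 = 0 := by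
  simp only [Linked, not_forall] at hij
  obtain ⟨z, hz, hne⟩ := hij
  by_cases hzi : z i.1 i.2 = 0
  · have hzj : z j.1 j.2 ≠ 0 := fun hzj => hne (iff_of_true hzi hzj)
    obtain ⟨v, hv, hvi⟩ := hi
    refine ⟨v - restrict (supp z) v, Y.sub_mem hv (h z hz v hv), ?_, ?_⟩
    · change v i.1 i.2 - restrict (supp z) v i.1 i.2 ≠ 0
      rwa [restrict_apply_of_notMem (not_not.2 hzi), sub_zero]
    · change v j.1 j.2 - restrict (supp z) v j.1 j.2 = 0
      rw [restrict_apply_of_mem (show j ∈ supp z from hzj), sub_self]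
  · refine ⟨z, hz, hzi, ?_⟩
    by_contra hzj
    exact hne (iff_of_false hzi hzj)

variable [Fact (1 ≤ p)]

/-- A class of linked coordinates is a countable intersection of supports of elements of `Y`, so
the restriction to it is a limit of repeated restrictions to supports. -/
theorem restrict_linked_mem (hp : p ≠ ∞) (hq : q ≠ ∞) (hY : IsClosed (Y : Set (EllPEllQ p q)))
    (h : ∀ x ∈ Y, ∀ y ∈ Y, restrict (supp x) y ∈ Y) {i : ℕ × ℕ}
    (hi : ∃ v ∈ Y, v i.1 i.2 ≠ 0) {y : EllPEllQ p q} (hy : y ∈ Y) :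
    restrict {j | Linked Y i j} y ∈ Y := by
  have hsep : ∀ j, ∃ v ∈ Y, v i.1 i.2 ≠ 0 ∧ (¬ Linked Y i j → v j.1 j.2 = 0) := by
    intro j
    by_cases hj : Linked Y i j
    · obtain ⟨v, hv, hvi⟩ := hi
      exact ⟨v, hv, hvi, fun h' => absurd hj h'⟩
    · obtain ⟨v, hv, hvi, hvj⟩ := exists_ne_zero_eq_zero_of_not_linked h hi hj
      exact ⟨v, hv, hvi, fun _ => hvj⟩
  choose v hvY hvi hvj using hsep
  set S : Finset (ℕ × ℕ) → Set (ℕ × ℕ) := fun F => {k | ∀ j ∈ F, k ∈ supp (v j)} with hS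
  have hmem : ∀ F, restrict (S F) y ∈ Y := by
    intro F
    induction F using Finset.induction_on with
    | empty =>
      have : restrict (S ∅) y = y := ext_coord fun k => restrict_apply_of_mem (by simp [hS]) y
      rwa [this]
    | insert j F _ ih =>
      have : restrict (S (insert j F)) y = restrict (supp (v j)) (restrict (S F) y) := by
        refine ext_coord fun k => ?_
        by_cases hk : k ∈ supp (v j)
        · rw [restrict_apply_of_mem hk]
          by_cases hkF : k ∈ S F
          · rw [restrict_apply_of_mem hkF, restrict_apply_of_mem
              (show k ∈ S (insert j F) from Finset.forall_mem_insert _ _ _ |>.2 ⟨hk, hkF⟩)]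
          · rw [restrict_apply_of_notMem hkF, restrict_apply_of_notMem
              fun (h' : k ∈ S (insert j F)) => hkF fun a ha => h' a (Finset.mem_insert_of_mem ha)]
        · rw [restrict_apply_of_notMem hk, restrict_apply_of_notMem
            fun (h' : k ∈ S (insert j F)) => hk (h' j (Finset.mem_insert_self j F))]
      rw [this]
      exact h _ (hvY j) _ ih
  refine hY.mem_of_tendsto (f := fun F => restrict (S F) y) (b := atTop) ?_
    (Eventually.of_forall hmem)
  refine tendsto_of_dominated hp hq (fun F k => norm_restrict_apply_le _ y k)
    (fun k => norm_restrict_apply_le _ y k) fun k => ?_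
  refine tendsto_const_nhds.congr' ?_
  by_cases hk : Linked Y i k
  · refine Eventually.of_forall fun F => ?_
    dsimp only
    rw [restrict_apply_of_mem (show k ∈ {j | Linked Y i j} from hk),
      restrict_apply_of_mem (show k ∈ S F from fun j _ h0 => hvi j ((hk _ (hvY j)).2 h0))]
  · filter_upwards [eventually_ge_atTop {k}] with F hF
    rw [restrict_apply_of_notMem (show k ∉ {j | Linked Y i j} from hk),
      restrict_apply_of_notMem fun (h' : k ∈ S F) =>
        h' k (hF (Finset.mem_singleton_self k)) (hvj k hk)]

/-- The classes of linked coordinates at which `Y` does not vanish. -/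
def linkedSetoid (Y : Submodule ℝ (EllPEllQ p q)) :
    Setoid {i : ℕ × ℕ // ∃ v ∈ Y, v i.1 i.2 ≠ 0} where
  r i j := Linked Y i j
  iseqv := ⟨fun _ _ _ => Iff.rfl, fun h z hz => (h z hz).symm,
    fun h h' z hz => (h z hz).trans (h' z hz)⟩

/-- Each class of linked coordinates carries a vector of `Y`, unique up to a factor: if `x, y ∈ Y`
then `y i • x - x i • y` vanishes at `i`, hence at all coordinates linked to `i`. These vectors form
an unconditional basis. -/
theorem exists_unconditional_disjoint_basis (hp : p ≠ ∞) (hq : q ≠ ∞)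
    (hY : IsClosed (Y : Set (EllPEllQ p q)))
    (h : ∀ x ∈ Y, ∀ y ∈ Y, restrict (supp x) y ∈ Y) :
    ∃ b : UnconditionalSchauderBasis (Quotient (linkedSetoid Y)) ℝ Y,
      ∀ c d, c ≠ d → AreDisjoint (b c : EllPEllQ p q) (b d : EllPEllQ p q) := by
  classical
  set rep : Quotient (linkedSetoid Y) → ℕ × ℕ := fun c => c.out.1 with hrep
  have hex : ∀ c, ∃ b ∈ Y, b (rep c).1 (rep c).2 = 1 ∧
      ∀ j : ℕ × ℕ, b j.1 j.2 ≠ 0 → Linked Y (rep c) j := by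
    intro c
    obtain ⟨v, hv, hvi⟩ := c.out.2
    refine ⟨restrict {j | Linked Y (rep c) j} ((v (rep c).1 (rep c).2)⁻¹ • v),
      restrict_linked_mem hp hq hY h c.out.2 (Y.smul_mem _ hv), ?_, fun j hj => ?_⟩
    · rw [restrict_apply_of_mem (show rep c ∈ {j | Linked Y (rep c) j} from fun _ _ => Iff.rfl)]
      exact inv_mul_cancel₀ hvi
    · by_contra hl
      exact hj (restrict_apply_of_notMem hl _)
  choose b hbY hb1 hbl using hex
  have hinj : ∀ c d, Linked Y (rep c) (rep d) → c = d := fun c d hcd =>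
    Quotient.out_equiv_out.1 hcd
  have hcoef : ∀ y ∈ Y, ∀ c, ∀ j : ℕ × ℕ,
      y (rep c).1 (rep c).2 * b c j.1 j.2 = if Linked Y (rep c) j then y j.1 j.2 else 0 := by
    intro y hy c j
    split_ifs with hl
    · have hu := (hl (y - y (rep c).1 (rep c).2 • b c)
        (Y.sub_mem hy (Y.smul_mem _ (hbY c)))).1 (by
          change y (rep c).1 (rep c).2 - y (rep c).1 (rep c).2 * b c (rep c).1 (rep c).2 = 0
          rw [hb1, mul_one, sub_self])
      exact (sub_eq_zero.1 hu).symm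
    · rw [not_not.1 (mt (hbl c j) hl), mul_zero]
  have hsumcoord : ∀ y : EllPEllQ p q, ∀ F : Finset (Quotient (linkedSetoid Y)), ∀ j : ℕ × ℕ,
      (∑ c ∈ F, y (rep c).1 (rep c).2 • b c) j.1 j.2
        = ∑ c ∈ F, y (rep c).1 (rep c).2 * b c j.1 j.2 := by
    intro y F j
    rw [← coord_apply, map_sum]
    rfl
  have hexp : ∀ y ∈ Y, HasSum (fun c => y (rep c).1 (rep c).2 • b c) y := by
    intro y hy
    have hval : ∀ F j, (∑ c ∈ F, y (rep c).1 (rep c).2 • b c) j.1 j.2 =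
        if ∃ c ∈ F, Linked Y (rep c) j then y j.1 j.2 else 0 := by
      intro F j
      rw [hsumcoord, Finset.sum_congr rfl fun c _ => hcoef y hy c j]
      split_ifs with hF
      · obtain ⟨c, hc, hl⟩ := hF
        rw [Finset.sum_eq_single_of_mem c hc, if_pos hl]
        intro d _ hdc
        refine if_neg fun hd => hdc (hinj d c fun z hz => (hd z hz).trans (hl z hz).symm)
      · exact Finset.sum_eq_zero fun c hc => if_neg fun hl => hF ⟨c, hc, hl⟩
    refine tendsto_of_dominated hp hq (g := y) (fun F j => ?_) (fun _ => le_rfl) fun j => ?_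
    · rw [hval]
      split_ifs
      · exact le_rfl
      · rw [norm_zero]
        exact norm_nonneg _
    · refine tendsto_const_nhds.congr' ?_
      by_cases hj : y j.1 j.2 = 0
      · exact Eventually.of_forall fun F => by dsimp only; rw [hval, hj, ite_self]
      · set c : Quotient (linkedSetoid Y) := Quotient.mk _ ⟨j, y, hy, hj⟩ with hc
        have hl : Linked Y (rep c) j := Quotient.mk_out (s := linkedSetoid Y) ⟨j, y, hy, hj⟩
        filter_upwards [eventually_ge_atTop {c}] with F hF
        rw [hval, if_pos ⟨c, hF (Finset.mem_singleton_self c), hl⟩]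
  refine ⟨⟨fun c => ⟨b c, hbY c⟩, fun c => (coord p q (rep c)).comp Y.subtypeL, fun c d => ?_,
    fun y => ?_⟩, fun c d hcd => ?_⟩
  · change b d (rep c).1 (rep c).2 = _
    by_cases hcd : c = d
    · subst hcd
      exact (hb1 c).trans (@Pi.single_eq_same _ (fun _ => ℝ) _ (Classical.decEq _) c 1).symm
    · refine Eq.trans ?_ (@Pi.single_eq_of_ne _ (fun _ => ℝ) _ (Classical.decEq _) _ _ hcd 1).symm
      by_contra hne
      exact hcd (hinj d c (hbl d _ hne)).symm
  · refine (Topology.IsInducing.subtypeVal.hasSum_iff (g := Y.subtype) _ _).1 ?_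
    exact hexp y y.2
  · refine Set.eq_empty_iff_forall_notMem.2 fun j hj => hcd (hinj c d fun z hz => ?_)
    exact (hbl c j hj.1 z hz).trans (hbl d j hj.2 z hz).symm

theorem hasBlockBasis_of_restrict_supp_mem (hp : p ≠ ∞) (hq : q ≠ ∞)
    (hY : IsClosed (Y : Set (EllPEllQ p q)))
    (h : ∀ x ∈ Y, ∀ y ∈ Y, restrict (supp x) y ∈ Y) : HasBlockBasis Y := by
  obtain ⟨b, hb⟩ := exists_unconditional_disjoint_basis hp hq hY h
  rcases finite_or_infinite (Quotient (linkedSetoid Y)) with hfin | hinf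
  · left
    have := Fintype.ofFinite (Quotient (linkedSetoid Y))
    have hspan : ⊤ ≤ Submodule.span ℝ (Set.range b) := fun y _ => by
      rw [← (hasSum_fintype _).unique (b.expansion y)]
      exact Submodule.sum_mem _ fun c _ =>
        Submodule.smul_mem _ _ (Submodule.subset_span ⟨c, rfl⟩)
    let e := Fintype.equivFin (Quotient (linkedSetoid Y))
    refine ⟨_, (Module.Basis.mk b.linearIndependent hspan).reindex e, fun i j hij => ?_⟩
    rw [Module.Basis.reindex_apply, Module.Basis.reindex_apply, Module.Basis.mk_apply,
      Module.Basis.mk_apply]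
    exact hb _ _ (e.symm.injective.ne hij)
  · right
    obtain ⟨_⟩ := nonempty_denumerable (Quotient (linkedSetoid Y))
    let e := (Denumerable.eqv (Quotient (linkedSetoid Y))).symm
    refine ⟨⟨fun n => b (e n), fun n => b.coord (e n), fun m n => ?_, fun y => ?_⟩,
      fun i j hij => hb _ _ (e.injective.ne hij)⟩
    · rw [b.ortho]
      simp [Pi.single_apply]
    · have := e.hasSum_iff.2 (b.expansion y)
      exact this.mono_left SummationFilter.LeAtTop.le_atTop

end Basis

end EllPEllQ

theorem corollary4p11 (p q : ℝ≥0∞) [Fact (1 ≤ p)] [Fact (1 ≤ q)]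
    (hpq : (1 < p ∧ p < 2 ∧ 2 < q ∧ q < ∞) ∨ (2 < p ∧ p < ∞ ∧ 1 < q ∧ q < 2))
    (P : EllPEllQ p q →L[ℝ] EllPEllQ p q) (hP : EllPEllQ.IsContractiveProjection P) :
    EllPEllQ.HasBlockBasis (LinearMap.range (P : EllPEllQ p q →ₗ[ℝ] EllPEllQ p q)) := by
  have hp : p ≠ ∞ := by
    rcases hpq with ⟨-, h, -⟩ | ⟨-, h, -⟩
    exacts [(h.trans ENNReal.ofNat_lt_top).ne, h.ne]
  have hq : q ≠ ∞ := by
    rcases hpq with ⟨-, -, -, h⟩ | ⟨-, -, -, h⟩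
    exacts [h.ne, (h.trans ENNReal.ofNat_lt_top).ne]
  have hmem : ∀ x, x ∈ LinearMap.range (P : EllPEllQ p q →ₗ[ℝ] EllPEllQ p q) ↔ P x = x :=
    fun x => ⟨by rintro ⟨z, rfl⟩; exact hP.idem z, fun hx => ⟨x, hx⟩⟩
  refine EllPEllQ.hasBlockBasis_of_restrict_supp_mem hp hq ?_ fun x hx y hy =>
    (hmem _).2 (hP.apply_restrict_supp hpq ((hmem x).1 hx) ((hmem y).1 hy))
  have : (LinearMap.range (P : EllPEllQ p q →ₗ[ℝ] EllPEllQ p q) : Set (EllPEllQ p q))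
      = {x | P x = x} := Set.ext hmem
  rw [this]
  exact isClosed_eq P.continuous continuous_id
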